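/- **Proposition (strongly orthogonal roots in $\mathrm{E}_8$).** Let $e_1,\dots,e_8$ be the standard orthonormal basis of $\mathbb{R}^8$, and for $I\subseteq\{1,\dots,8\}$ put $\zeta_I=\tfrac12\big(\sum_{i\in I}e_i-\sum_{i\notin I}e_i\big)$. Let $$\mathcal{R}=\{\pm e_i\pm e_j \mid 1\le i<j\le 8\}\cup\{\zeta_I \mid \#I \text{ even}\}$$ be the root system of type $\mathrm{E}_8$. For $v\neq0$ let $s_v(x)=x-\frac{2(x\mid v)}{(v\mid v)}v$, and let $W$ be the Weyl group, i.e. the group of isometries of $\mathbb{R}^8$ generated by the $s_\alpha$, $\alpha\in\mathcal{R}$. Two roots $\alpha,\beta$ with $\alpha\neq\pm\beta$ are *strongly orthogonal* if neither $\alpha+\beta$ nor $\alpha-\beta$ is a root. A *system of strongly orthogonal roots* is a finite set of roots, any two distinct elements of which are strongly orthogonal. Two systems $S,S'$ are *equivalent* if $w(S)=S'$ for some $w\in W$. For pairwise orthogonal nonzero vectors $v_1,v_2,v_3,v_4$ of equal length let $K_4(v_1,v_2,v_3,v_4)$ be the Klein $4$-group of isometries of $\mathbb{R}^8$ consisting of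 $$\mathrm{id},\quad s_{v_1-v_2}\circ s_{v_3-v_4},\quad s_{v_1-v_3}\circ s_{v_2-v_4},\quad s_{v_1-v_4}\circ s_{v_2-v_3}.$$ 1. For every integer $k\ge0$ with $k\neq4$, any two systems of $k$ strongly orthogonal roots of $\mathcal{R}$ are equivalent. 2. There are exactly two equivalence classes of systems $\{\alpha_1,\alpha_2,\alpha_3,\alpha_4\}$ of four strongly orthogonal roots of $\mathcal{R}$: class (I) consists of those with $K_4(\alpha_1,\alpha_2,\alpha_3,\alpha_4)\subseteq W$, and class (II) of those with $K_4(\alpha_1,\alpha_2,\alpha_3,\alpha_4)\not\subseteq W$. That is, both kinds occur, and two such systems, enumerated in any order, are equivalent if and only if they are of the same kind. -/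

import Mathlib

open scoped RealInnerProductSpace

namespace E8

/-- The Euclidean space `ℝ⁸`, with orthonormal basis `e 0, …, e 7`. -/
abbrev V : Type := EuclideanSpace ℝ (Fin 8)

/-- The standard orthonormal basis vectors. -/
noncomputable def e (i : Fin 8) : V := EuclideanSpace.single i 1

/-- The vector `ζ_I = ½ (∑_{i ∈ I} e_i - ∑_{i ∉ I} e_i)`. -/
noncomputable def zeta (I : Finset (Fin 8)) : V :=
  (1 / 2 : ℝ) • (∑ i ∈ I, e i - ∑ i ∈ Iᶜ, e i)

/-- The root system `E₈`: the 112 vectors `± e_i ± e_j` with `i ≠ j`, and the 128 vectors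
`ζ_I` with `#I` even (these are `± ζ_∅`, `± ζ_{i,j}` and `ζ_{i,j,h,k}`, since
`- ζ_I = ζ_{Iᶜ}`). -/
def roots : Set V :=
  {v | ∃ i j : Fin 8, i ≠ j ∧ (v = e i + e j ∨ v = e i - e j ∨ v = -e i - e j)} ∪
  {v | ∃ I : Finset (Fin 8), Even I.card ∧ v = zeta I}

/-- The orthogonal reflection `s_v` of `ℝ⁸` in the hyperplane perpendicular to `v`. -/
noncomputable def refl (v : V) : V ≃ₗᵢ[ℝ] V := (ℝ ∙ v)ᗮ.reflection

theorem refl_apply (v x : V) : refl v x = x - (2 * ⟪x, v⟫ / ⟪v, v⟫) • v := by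
  rw [refl, Submodule.reflection_orthogonal_apply, Submodule.reflection_singleton_apply,
    real_inner_comm v x, real_inner_self_eq_norm_sq]
  simp only [RCLike.ofReal_real_eq_id, id_eq, two_smul, two_mul, add_div, add_smul]
  abel

/-- The Weyl group of `E₈`: the group of isometries generated by the root reflections. -/
noncomputable def weylGroup : Subgroup (V ≃ₗᵢ[ℝ] V) := Subgroup.closure (refl '' roots)

/-- Strong orthogonality of two roots: they are not proportional, and neither their sum nor
their difference is a root. -/
def StronglyOrthogonal (α β : V) : Prop :=
  α ≠ β ∧ α ≠ -β ∧ α + β ∉ roots ∧ α - β ∉ roots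

/-- A system of strongly orthogonal roots: a finite set of roots, any two distinct members of
which are strongly orthogonal. -/
def IsStronglyOrthogonalSystem (S : Finset V) : Prop :=
  (S : Set V) ⊆ roots ∧ (S : Set V).Pairwise StronglyOrthogonal

/-- Two sets of vectors are equivalent if an element of the Weyl group maps the first onto the
second. -/
def WeylEquivalent (S T : Set V) : Prop := ∃ w ∈ weylGroup, w '' S = T

/-- The set of four isometries
`id, s_{v₀-v₁} ∘ s_{v₂-v₃}, s_{v₀-v₂} ∘ s_{v₁-v₃}, s_{v₀-v₃} ∘ s_{v₁-v₂}`.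
For pairwise orthogonal nonzero vectors of the same length it is the Klein four-group which
permutes these vectors by the identity and the three double transpositions, and fixes their
orthogonal complement pointwise. -/
noncomputable def klein (v : Fin 4 → V) : Set (V ≃ₗᵢ[ℝ] V) :=
  {1, refl (v 0 - v 1) * refl (v 2 - v 3), refl (v 0 - v 2) * refl (v 1 - v 3),
    refl (v 0 - v 3) * refl (v 1 - v 2)}

/-- An enumeration, without repetitions, of a system of four strongly orthogonal roots. -/
def IsStronglyOrthogonalQuadruple (α : Fin 4 → V) : Prop :=
  (∀ i, α i ∈ roots) ∧ Pairwise fun i j => StronglyOrthogonal (α i) (α j)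

end E8

/-!
The roots are exactly the vectors of square length `2` in the `E₈` lattice, which is even and
self-dual; in particular strongly orthogonal roots are just orthogonal roots. For orthogonal
vectors `u`, `v` of square length `4` in the lattice, `s_u s_v = s_{(u + v) / 2} s_{(u - v) / 2}`,
and by self-duality this isometry preserves the lattice only if `(u + v) / 2` belongs to it, in
which case `(u ± v) / 2` are roots. Hence `K₄(α₁, α₂, α₃, α₄) ⊆ W` if and only if
`(α₁ + α₂ + α₃ + α₄) / 2` is a lattice vector, a condition which depends only on the equivalence
class of the system.

Moving one root after another, `W` carries every system into a fixed frame of eight orthogonal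
roots. Label the frame by `𝔽₂³` so that half the sum of four frame vectors lies in the lattice when
their labels add up to `0` (the extended Hamming code). Then `W` induces on the frame all products
`(i j) (c i+j+c)` of two transpositions. Such a product exchanges a single element `i` of a set `A`
of labels for `j` as soon as `c` and `i+j+c` are both inside or both outside `A`, and this is
impossible for every `c` only if translation by `i+j` maps `A` onto its complement, so that `A` has
four elements. Among the four-element sets, the same exchange starting from three prescribed labels
leaves two candidates, which the lattice condition tells apart.
-/

namespace E8

/-- The `E₈` lattice: the vectors whose coordinates are all integers or all half-odd integers, with
even coordinate sum. Writing `x i = a / 2 + m i` makes the sum `4 * a + ∑ i, m i`, so it is even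
precisely when `∑ i, m i` is. -/
def lattice : AddSubgroup V where
  carrier := {x | ∃ (a : ℤ) (m : Fin 8 → ℤ), (∀ i, x i = a / 2 + m i) ∧ Even (∑ i, m i)}
  zero_mem' := ⟨0, 0, by simp, by simp⟩
  add_mem' := by
    rintro x y ⟨a, m, hx, hm⟩ ⟨b, n, hy, hn⟩
    refine ⟨a + b, m + n, fun i => ?_, ?_⟩
    · simp only [PiLp.add_apply, Pi.add_apply, hx, hy]
      push_cast
      ring
    · simpa only [Pi.add_apply, Finset.sum_add_distrib] using hm.add hn
  neg_mem' := by
    rintro x ⟨a, m, hx, hm⟩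
    refine ⟨-a, -m, fun i => ?_, ?_⟩
    · simp only [PiLp.neg_apply, Pi.neg_apply, hx]
      push_cast
      ring
    · simpa only [Pi.neg_apply, Finset.sum_neg_distrib] using hm.neg

theorem inner_eq_sum_mul (x y : V) : ⟪x, y⟫ = ∑ i, x i * y i := by
  simp [PiLp.inner_apply, mul_comm]

theorem e_apply (i j : Fin 8) : e i j = if j = i then 1 else 0 := by
  simp [e]

theorem inner_e_left (i : Fin 8) (x : V) : ⟪e i, x⟫ = x i := by
  simp [inner_eq_sum_mul, e_apply]

theorem zeta_apply (I : Finset (Fin 8)) (i : Fin 8) :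
    zeta I i = if i ∈ I then 1 / 2 else -(1 / 2) := by
  simp only [zeta, PiLp.smul_apply, PiLp.sub_apply, WithLp.ofLp_sum, Finset.sum_apply, e_apply,
    Finset.sum_ite_eq, Finset.mem_compl, smul_eq_mul]
  split_ifs <;> simp_all

theorem exists_int_inner_eq {x y : V} (hx : x ∈ lattice) (hy : y ∈ lattice) :
    ∃ n : ℤ, ⟪x, y⟫ = n := by
  obtain ⟨a, m, hx, k, hk⟩ := hx
  obtain ⟨b, n, hy, l, hl⟩ := hy
  have hk' : ∑ i, (m i : ℝ) = k + k := by exact_mod_cast hk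
  have hl' : ∑ i, (n i : ℝ) = l + l := by exact_mod_cast hl
  refine ⟨2 * a * b + a * l + b * k + ∑ i, m i * n i, ?_⟩
  calc ⟪x, y⟫ = ∑ i, ((a * b / 4 : ℝ) + a / 2 * n i + b / 2 * m i + m i * n i) := by
        rw [inner_eq_sum_mul]
        exact Finset.sum_congr rfl fun i _ => by rw [hx, hy]; ring
    _ = _ := by
        simp only [Finset.sum_add_distrib, ← Finset.mul_sum, hk', hl', Finset.sum_const,
          Finset.card_univ, Fintype.card_fin]
        push_cast
        ring

theorem exists_inner_self_eq_two_mul {x : V} (hx : x ∈ lattice) :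
    ∃ n : ℤ, ⟪x, x⟫ = 2 * n := by
  obtain ⟨a, m, hx, k, hk⟩ := hx
  have hsq : Even (∑ i, m i ^ 2) := by
    have : Even (∑ i, (m i ^ 2 - m i)) :=
      Finset.even_sum _ fun i _ => by simpa [sq, mul_sub] using Int.even_mul_pred_self (m i)
    rw [Finset.sum_sub_distrib] at this
    exact (Int.even_sub.1 this).2 ⟨k, hk⟩
  obtain ⟨s, hs⟩ := hsq
  have hk' : ∑ i, (m i : ℝ) = k + k := by exact_mod_cast hk
  have hs' : ∑ i, (m i : ℝ) ^ 2 = s + s := by exact_mod_cast hs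
  refine ⟨a ^ 2 + a * k + s, ?_⟩
  calc ⟪x, x⟫ = ∑ i, ((a ^ 2 / 4 : ℝ) + a * m i + (m i : ℝ) ^ 2) := by
        rw [inner_eq_sum_mul]
        exact Finset.sum_congr rfl fun i _ => by rw [hx]; ring
    _ = _ := by
        simp only [Finset.sum_add_distrib, ← Finset.mul_sum, hk', hs', Finset.sum_const,
          Finset.card_univ, Fintype.card_fin]
        push_cast
        ring

theorem e_add_e_mem_lattice (i j : Fin 8) : e i + e j ∈ lattice :=
  ⟨0, Pi.single i 1 + Pi.single j 1, fun k => by simp [e_apply, Pi.single_apply],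
    by simp [Finset.sum_add_distrib]⟩

theorem zeta_mem_lattice {I : Finset (Fin 8)} (hI : Even I.card) : zeta I ∈ lattice := by
  refine ⟨-1, fun i => if i ∈ I then 1 else 0, fun i => ?_, by simpa using hI⟩
  rw [zeta_apply]
  split_ifs with hi <;> norm_num [hi]

theorem mem_lattice_of_mem_roots {x : V} (hx : x ∈ roots) : x ∈ lattice := by
  rcases hx with ⟨i, j, -, rfl | rfl | rfl⟩ | ⟨I, hI, rfl⟩
  · exact e_add_e_mem_lattice i j
  · have : e i - e j = e i + e j - (e j + e j) := by abel
    exact this ▸ sub_mem (e_add_e_mem_lattice i j) (e_add_e_mem_lattice j j)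
  · have : -e i - e j = -(e i + e j) := by abel
    exact this ▸ neg_mem (e_add_e_mem_lattice i j)
  · exact zeta_mem_lattice hI

theorem inner_self_of_mem_roots {x : V} (hx : x ∈ roots) : ⟪x, x⟫ = 2 := by
  rcases hx with ⟨i, j, hij, rfl | rfl | rfl⟩ | ⟨I, -, rfl⟩
  · rw [inner_add_left, inner_e_left, inner_e_left]
    norm_num [e_apply, hij, hij.symm]
  · rw [inner_sub_left, inner_e_left, inner_e_left]
    norm_num [e_apply, hij, hij.symm]
  · rw [inner_sub_left, inner_neg_left, inner_e_left, inner_e_left]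
    norm_num [e_apply, hij, hij.symm]
  · have : ∀ i, zeta I i * zeta I i = 1 / 4 := fun i => by
      rw [zeta_apply]
      split_ifs <;> norm_num
    rw [inner_eq_sum_mul, Finset.sum_congr rfl fun i _ => this i]
    norm_num

theorem exists_eq_single_add_single_of_sum_sq_eq_two {ι : Type*} [Fintype ι] [DecidableEq ι]
    {n : ι → ℤ} (hn : ∑ i, n i ^ 2 = 2) :
    ∃ i j, i ≠ j ∧ IsUnit (n i) ∧ IsUnit (n j) ∧
      n = Pi.single i (n i) + Pi.single j (n j) := by
  have hcases : ∀ i, n i = 0 ∨ IsUnit (n i) := fun i => by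
    have : n i ^ 2 ≤ 2 := hn ▸ Finset.single_le_sum (f := fun i => n i ^ 2)
      (fun j _ => sq_nonneg (n j)) (Finset.mem_univ i)
    have : n i < 2 := by nlinarith
    have : -2 < n i := by nlinarith
    rw [Int.isUnit_iff]
    omega
  have hsupp : (Finset.univ.filter (n · ≠ 0)).card = 2 := by
    have : ∀ i, n i ^ 2 = if n i ≠ 0 then 1 else 0 := fun i => by
      rcases hcases i with h | h
      · simp [h]
      · simp [h.ne_zero, Int.isUnit_sq h]
    rw [Finset.sum_congr rfl fun i _ => this i, Finset.sum_boole] at hn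
    exact_mod_cast hn
  obtain ⟨i, j, hij, hs⟩ := Finset.card_eq_two.1 hsupp
  have hmem : ∀ k, n k ≠ 0 ↔ k = i ∨ k = j := fun k => by
    simpa using Finset.ext_iff.1 hs k
  refine ⟨i, j, hij, (hcases i).resolve_left ((hmem i).2 (Or.inl rfl)),
    (hcases j).resolve_left ((hmem j).2 (Or.inr rfl)), funext fun k => ?_⟩
  by_cases hki : k = i
  · subst hki
    simp [hij]
  by_cases hkj : k = j
  · subst hkj
    simp [hij.symm]
  · simpa [hki, hkj] using not_not.1 (mt (hmem k).1 (not_or.2 ⟨hki, hkj⟩))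

theorem mem_roots_of_int_coords {x : V} {n : Fin 8 → ℤ} (hn : ∀ i, x i = n i)
    (hx : ⟪x, x⟫ = 2) : x ∈ roots := by
  have hsum : ∑ i, n i ^ 2 = 2 := by
    have : ∑ i, (n i : ℝ) ^ 2 = 2 := by simpa only [inner_eq_sum_mul, hn, sq] using hx
    exact_mod_cast this
  obtain ⟨i, j, hij, hi, hj, hnij⟩ := exists_eq_single_add_single_of_sum_sq_eq_two hsum
  have hxe : x = (n i : ℝ) • e i + (n j : ℝ) • e j := by
    ext k
    rw [hn, hnij]
    simp [e_apply, Pi.single_apply, hij, hij.symm]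
  left
  rcases Int.isUnit_iff.1 hi with hi | hi <;> rcases Int.isUnit_iff.1 hj with hj | hj <;>
    rw [hxe, hi, hj]
  · exact ⟨i, j, hij, Or.inl (by simp)⟩
  · exact ⟨i, j, hij, Or.inr (Or.inl (by simp [sub_eq_add_neg]))⟩
  · exact ⟨j, i, hij.symm, Or.inr (Or.inl (by simp [sub_eq_add_neg, add_comm]))⟩
  · exact ⟨i, j, hij, Or.inr (Or.inr (by simp [sub_eq_add_neg]))⟩

theorem mem_roots_of_half_odd_coords {x : V} {n : Fin 8 → ℤ} (hn : ∀ i, x i = n i + 1 / 2)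
    (heven : Even (∑ i, n i)) (hx : ⟪x, x⟫ = 2) : x ∈ roots := by
  have hnonneg : ∀ i, 0 ≤ n i * (n i + 1) := fun i => by
    rcases le_or_gt 0 (n i) with h | h
    · positivity
    · exact mul_nonneg_of_nonpos_of_nonpos h.le h
  have hsum : ∑ i, n i * (n i + 1) = 0 := by
    have : ∑ i, ((1 / 4 : ℝ) + n i * (n i + 1)) = 2 := by
      rw [← hx, inner_eq_sum_mul]
      exact Finset.sum_congr rfl fun i _ => by rw [hn]; ring
    rw [Finset.sum_add_distrib] at this
    norm_num at this
    exact_mod_cast this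
  have hcases : ∀ i, n i = 0 ∨ n i = -1 := fun i => by
    have := (Finset.sum_eq_zero_iff_of_nonneg fun i _ => hnonneg i).1 hsum i (Finset.mem_univ i)
    rcases mul_eq_zero.1 this with h | h <;> omega
  refine Or.inr ⟨Finset.univ.filter (n · = 0), ?_, ?_⟩
  · have : ∀ i, n i = (if n i = 0 then 1 else 0) - 1 := fun i => by
      rcases hcases i with h | h <;> simp [h]
    rw [Finset.sum_congr rfl fun i _ => this i, Finset.sum_sub_distrib, Finset.sum_boole,
      Int.even_sub] at heven
    exact_mod_cast heven.2 (by decide)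
  · ext i
    rw [zeta_apply, hn]
    rcases hcases i with h | h <;> norm_num [h]

theorem mem_roots_iff {x : V} : x ∈ roots ↔ x ∈ lattice ∧ ⟪x, x⟫ = 2 := by
  refine ⟨fun hx => ⟨mem_lattice_of_mem_roots hx, inner_self_of_mem_roots hx⟩, ?_⟩
  rintro ⟨⟨a, m, hm, heven⟩, hx⟩
  rcases Int.even_or_odd' a with ⟨c, rfl | rfl⟩
  · refine mem_roots_of_int_coords (n := fun i => c + m i) (fun i => ?_) hx
    rw [hm]
    push_cast
    ring
  · refine mem_roots_of_half_odd_coords (n := fun i => c + m i) (fun i => ?_) ?_ hx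
    · rw [hm]
      push_cast
      ring
    · rw [Finset.sum_add_distrib]
      have : Even (∑ _ : Fin 8, c) :=
        ⟨4 * c, by simp only [Finset.sum_const, Finset.card_fin]; ring⟩
      exact this.add heven

theorem mem_lattice_of_forall_exists_int_inner_eq {x : V}
    (hx : ∀ r ∈ roots, ∃ n : ℤ, ⟪r, x⟫ = n) : x ∈ lattice := by
  have hadd : ∀ i j, i ≠ j → ∃ n : ℤ, x i + x j = n := fun i j hij => by
    simpa only [inner_add_left, inner_e_left] using hx _ (Or.inl ⟨i, j, hij, Or.inl rfl⟩)
  have hsub : ∀ i, ∃ n : ℤ, x i - x 0 = n := fun i => by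
    rcases eq_or_ne i 0 with rfl | hi
    · exact ⟨0, by simp⟩
    · simpa only [inner_sub_left, inner_e_left] using
        hx _ (Or.inl ⟨i, 0, hi, Or.inr (Or.inl rfl)⟩)
  choose m hm using hsub
  obtain ⟨a, ha⟩ := hadd 1 0 (by decide)
  obtain ⟨s, hs⟩ := hx (zeta Finset.univ) (Or.inr ⟨_, by decide, rfl⟩)
  have h0 : x 0 = ((a - m 1 : ℤ) : ℝ) / 2 := by
    push_cast
    linarith [hm 1]
  refine ⟨a - m 1, m, fun i => by linarith [hm i], s - 2 * (a - m 1), ?_⟩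
  have hsum : ∑ i, x i = 8 * x 0 + ∑ i, (m i : ℝ) := by
    rw [Finset.sum_congr rfl fun i _ => eq_add_of_sub_eq' (hm i), Finset.sum_add_distrib]
    simp
  simp only [inner_eq_sum_mul, zeta_apply, Finset.mem_univ, if_true, ← Finset.mul_sum, hsum,
    h0] at hs
  have : ∑ i, (m i : ℝ) = ((s - 2 * (a - m 1) + (s - 2 * (a - m 1)) : ℤ) : ℝ) := by
    push_cast at hs ⊢
    linarith
  exact_mod_cast this

theorem neg_mem_roots {x : V} (hx : x ∈ roots) : -x ∈ roots := by
  rw [mem_roots_iff] at hx ⊢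
  exact ⟨neg_mem hx.1, by rw [inner_neg_neg, hx.2]⟩

theorem sub_mem_roots_of_inner_pos {x y : V} (hx : x ∈ roots) (hy : y ∈ roots)
    (hpos : 0 < ⟪x, y⟫) (hne : x ≠ y) : x - y ∈ roots := by
  obtain ⟨n, hn⟩ := exists_int_inner_eq (mem_lattice_of_mem_roots hx) (mem_lattice_of_mem_roots hy)
  have hself : ⟪x - y, x - y⟫ = 4 - 2 * n := by
    rw [real_inner_sub_sub_self, inner_self_of_mem_roots hx, inner_self_of_mem_roots hy, hn]
    ring
  have hpos' : 0 < n := by exact_mod_cast hn ▸ hpos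
  have hlt : n < 2 := by
    have : 0 < ⟪x - y, x - y⟫ := real_inner_self_pos.2 (sub_ne_zero.2 hne)
    rw [hself] at this
    exact_mod_cast (by linarith : (n : ℝ) < 2)
  obtain rfl : n = 1 := by omega
  refine mem_roots_iff.2
    ⟨sub_mem (mem_lattice_of_mem_roots hx) (mem_lattice_of_mem_roots hy), ?_⟩
  rw [hself]
  norm_num

theorem stronglyOrthogonal_iff {x y : V} (hx : x ∈ roots) (hy : y ∈ roots) :
    StronglyOrthogonal x y ↔ ⟪x, y⟫ = 0 := by
  have hxx := inner_self_of_mem_roots hx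
  have hyy := inner_self_of_mem_roots hy
  constructor
  · rintro ⟨hne, hne', hadd, hsub⟩
    rcases lt_trichotomy ⟪x, y⟫ 0 with h | h | h
    · refine absurd ?_ hadd
      rw [← sub_neg_eq_add]
      exact sub_mem_roots_of_inner_pos hx (neg_mem_roots hy) (by rwa [inner_neg_right, neg_pos])
        hne'
    · exact h
    · exact absurd (sub_mem_roots_of_inner_pos hx hy h hne) hsub
  · intro h
    refine ⟨?_, ?_, fun hr => ?_, fun hr => ?_⟩
    · rintro rfl
      linarith
    · rintro rfl
      rw [inner_neg_left] at h
      linarith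
    · have := inner_self_of_mem_roots hr
      rw [real_inner_add_add_self] at this
      linarith
    · have := inner_self_of_mem_roots hr
      rw [real_inner_sub_sub_self] at this
      linarith

theorem refl_apply_of_inner_eq_zero {v x : V} (h : ⟪x, v⟫ = 0) : refl v x = x := by
  simp [refl_apply, h]

theorem refl_self (v : V) : refl v v = -v :=
  Submodule.reflection_orthogonalComplement_singleton_eq_neg v

theorem refl_refl (v x : V) : refl v (refl v x) = x :=
  Submodule.reflection_reflection _ x

theorem refl_smul {c : ℝ} (hc : c ≠ 0) (v : V) : refl (c • v) = refl v := by
  simp only [refl, Submodule.span_singleton_smul_eq hc.isUnit]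

theorem refl_apply_of_mem_roots {v : V} (hv : v ∈ roots) (x : V) :
    refl v x = x - ⟪x, v⟫ • v := by
  rw [refl_apply, inner_self_of_mem_roots hv, mul_div_cancel_left₀ _ two_ne_zero]

/- Both sides act as `-1` on the plane spanned by `u` and `v`, and trivially on its complement. -/
theorem refl_mul_refl {u v : V} (hnorm : ⟪u, u⟫ = ⟪v, v⟫) (hperp : ⟪u, v⟫ = 0) :
    refl u * refl v = refl (u + v) * refl (u - v) := by
  rcases eq_or_ne v 0 with rfl | hv
  · obtain rfl : u = 0 := by simpa using hnorm
    simp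
  have hvv : ⟪v, v⟫ ≠ 0 := inner_self_ne_zero.2 hv
  have hperp' : ⟪v, u⟫ = 0 := by rwa [real_inner_comm]
  ext1 x
  simp only [LinearIsometryEquiv.coe_mul, Function.comp_apply, refl_apply, inner_add_left,
    inner_add_right, inner_sub_left, inner_sub_right, real_inner_smul_left, hperp, hperp', hnorm]
  match_scalars <;> field_simp <;> ring

theorem refl_mem_weylGroup {v : V} (hv : v ∈ roots) : refl v ∈ weylGroup :=
  Subgroup.subset_closure ⟨v, hv, rfl⟩

theorem refl_apply_mem_lattice_iff {v x : V} (hv : v ∈ roots) :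
    refl v x ∈ lattice ↔ x ∈ lattice := by
  have hmem : ∀ y ∈ lattice, refl v y ∈ lattice := fun y hy => by
    obtain ⟨n, hn⟩ := exists_int_inner_eq hy (mem_lattice_of_mem_roots hv)
    rw [refl_apply_of_mem_roots hv, hn, Int.cast_smul_eq_zsmul]
    exact sub_mem hy (zsmul_mem (mem_lattice_of_mem_roots hv) n)
  refine ⟨fun h => ?_, hmem x⟩
  simpa only [refl_refl] using hmem _ h

theorem map_mem_lattice_iff {w : V ≃ₗᵢ[ℝ] V} (hw : w ∈ weylGroup) (x : V) :
    w x ∈ lattice ↔ x ∈ lattice := by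
  induction hw using Subgroup.closure_induction generalizing x with
  | mem w hw =>
    obtain ⟨v, hv, rfl⟩ := hw
    exact refl_apply_mem_lattice_iff hv
  | one => rfl
  | mul w w' _ _ ihw ihw' => exact (ihw (w' x)).trans (ihw' x)
  | inv w _ ihw => simpa using (ihw (w⁻¹ x)).symm

theorem map_mem_roots {w : V ≃ₗᵢ[ℝ] V} (hw : w ∈ weylGroup) {x : V} (hx : x ∈ roots) :
    w x ∈ roots := by
  rw [mem_roots_iff] at hx ⊢
  exact ⟨(map_mem_lattice_iff hw x).2 hx.1, by rw [LinearIsometryEquiv.inner_map_map, hx.2]⟩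

theorem exists_map_eq_of_inner_pos {x y : V} (hx : x ∈ roots) (hy : y ∈ roots)
    (h : 0 < ⟪x, y⟫) :
    ∃ w ∈ weylGroup, w x = y ∧ ∀ p, ⟪p, x⟫ = 0 → ⟪p, y⟫ = 0 → w p = p := by
  rcases eq_or_ne x y with rfl | hne
  · exact ⟨1, one_mem _, rfl, fun p _ _ => rfl⟩
  have hnorm : ‖x‖ = ‖y‖ := by
    rw [norm_eq_sqrt_real_inner, norm_eq_sqrt_real_inner, inner_self_of_mem_roots hx,
      inner_self_of_mem_roots hy]
  refine ⟨refl (x - y), refl_mem_weylGroup (sub_mem_roots_of_inner_pos hx hy h hne),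
    Submodule.reflection_sub hnorm, fun p hpx hpy => refl_apply_of_inner_eq_zero ?_⟩
  rw [inner_sub_right, hpx, hpy, sub_zero]

theorem exists_map_eq_of_inner_ne_zero {x y : V} (hx : x ∈ roots) (hy : y ∈ roots)
    (h : ⟪x, y⟫ ≠ 0) :
    ∃ w ∈ weylGroup, w x = y ∧ ∀ p, ⟪p, x⟫ = 0 → ⟪p, y⟫ = 0 → w p = p := by
  rcases h.lt_or_gt with hneg | hpos
  · obtain ⟨w, hw, hwx, hfix⟩ := exists_map_eq_of_inner_pos hx (neg_mem_roots hy)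
      (by rwa [inner_neg_right, neg_pos])
    refine ⟨refl y * w, mul_mem (refl_mem_weylGroup hy) hw, ?_, fun p hpx hpy => ?_⟩
    · rw [LinearIsometryEquiv.coe_mul, Function.comp_apply, hwx, map_neg, refl_self, neg_neg]
    · rw [LinearIsometryEquiv.coe_mul, Function.comp_apply,
        hfix p hpx (by rw [inner_neg_right, hpy, neg_zero]), refl_apply_of_inner_eq_zero hpy]
  · exact exists_map_eq_of_inner_pos hx hy hpos

theorem WeylEquivalent.symm {S T : Set V} (h : WeylEquivalent S T) : WeylEquivalent T S := by
  obtain ⟨w, hw, rfl⟩ := h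
  exact ⟨w⁻¹, inv_mem hw, by simp [← Set.image_comp]⟩

theorem WeylEquivalent.trans {S T U : Set V} (hST : WeylEquivalent S T)
    (hTU : WeylEquivalent T U) : WeylEquivalent S U := by
  obtain ⟨w, hw, rfl⟩ := hST
  obtain ⟨w', hw', rfl⟩ := hTU
  exact ⟨w' * w, mul_mem hw' hw, by rw [LinearIsometryEquiv.coe_mul, Set.image_comp]⟩

theorem half_smul_notMem_lattice {u : V} (hu : ⟪u, u⟫ = 4) : (1 / 2 : ℝ) • u ∉ lattice := by
  intro h
  obtain ⟨n, hn⟩ := exists_inner_self_eq_two_mul h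
  rw [real_inner_smul_left, real_inner_smul_right, hu] at hn
  have : 1 = 2 * n := by exact_mod_cast (by linarith : (1 : ℝ) = 2 * n)
  omega

/- A root `r` with `⟪r, u⟫` odd exists since `u / 2` is not in the self-dual lattice; the vector by
which `s_u s_v` moves `r` is half of an integral combination of `u` and `v`. -/
theorem half_smul_add_mem_lattice_of_refl_mul_refl_mem_weylGroup {u v : V} (hu : u ∈ lattice)
    (hv : v ∈ lattice) (huu : ⟪u, u⟫ = 4) (hvv : ⟪v, v⟫ = 4) (huv : ⟪u, v⟫ = 0)
    (h : refl u * refl v ∈ weylGroup) : (1 / 2 : ℝ) • (u + v) ∈ lattice := by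
  obtain ⟨r, hr, hru⟩ : ∃ r ∈ roots, ¬ ∃ n : ℤ, ⟪r, (1 / 2 : ℝ) • u⟫ = n := by
    by_contra! hint
    exact half_smul_notMem_lattice huu (mem_lattice_of_forall_exists_int_inner_eq hint)
  have hr := mem_lattice_of_mem_roots hr
  obtain ⟨p, hp⟩ := exists_int_inner_eq hr hu
  obtain ⟨q, hq⟩ := exists_int_inner_eq hr hv
  have hmove : (p / 2 : ℝ) • u + (q / 2 : ℝ) • v ∈ lattice := by
    have : (p / 2 : ℝ) • u + (q / 2 : ℝ) • v = r - (refl u * refl v) r := by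
      simp only [LinearIsometryEquiv.coe_mul, Function.comp_apply, refl_apply, inner_sub_left,
        real_inner_smul_left, real_inner_comm u v, huv, hp, hq, huu, hvv]
      module
    rw [this]
    exact sub_mem hr ((map_mem_lattice_iff h r).2 hr)
  obtain ⟨k, rfl⟩ : Odd p := by
    by_contra hp_odd
    obtain ⟨k, rfl⟩ := Int.not_odd_iff_even.1 hp_odd
    refine hru ⟨k, ?_⟩
    rw [real_inner_smul_right, hp]
    push_cast
    ring
  rcases Int.even_or_odd' q with ⟨l, rfl | rfl⟩
  · refine absurd ?_ (half_smul_notMem_lattice huu)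
    convert sub_mem hmove (add_mem (zsmul_mem hu k) (zsmul_mem hv l)) using 1
    push_cast
    module
  · convert sub_mem hmove (add_mem (zsmul_mem hu k) (zsmul_mem hv l)) using 1
    push_cast
    module

theorem refl_mul_refl_mem_weylGroup_iff {u v : V} (hu : u ∈ lattice) (hv : v ∈ lattice)
    (huu : ⟪u, u⟫ = 4) (hvv : ⟪v, v⟫ = 4) (huv : ⟪u, v⟫ = 0) :
    refl u * refl v ∈ weylGroup ↔ (1 / 2 : ℝ) • (u + v) ∈ lattice := by
  refine ⟨half_smul_add_mem_lattice_of_refl_mul_refl_mem_weylGroup hu hv huu hvv huv,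
    fun hadd => ?_⟩
  have hsub : (1 / 2 : ℝ) • (u - v) ∈ lattice := by
    convert sub_mem hadd hv using 1
    module
  have hadd_root : (1 / 2 : ℝ) • (u + v) ∈ roots := by
    refine mem_roots_iff.2 ⟨hadd, ?_⟩
    rw [real_inner_smul_left, real_inner_smul_right, real_inner_add_add_self, huu, hvv, huv]
    norm_num
  have hsub_root : (1 / 2 : ℝ) • (u - v) ∈ roots := by
    refine mem_roots_iff.2 ⟨hsub, ?_⟩
    rw [real_inner_smul_left, real_inner_smul_right, real_inner_sub_sub_self, huu, hvv, huv]
    norm_num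
  rw [refl_mul_refl (huu.trans hvv.symm) huv, ← refl_smul one_half_pos.ne' (u + v),
    ← refl_smul one_half_pos.ne' (u - v)]
  exact mul_mem (refl_mem_weylGroup hadd_root) (refl_mem_weylGroup hsub_root)

theorem refl_sub_mul_refl_sub_mem_weylGroup_iff {a b c d : V} (ha : a ∈ roots) (hb : b ∈ roots)
    (hc : c ∈ roots) (hd : d ∈ roots) (hab : ⟪a, b⟫ = 0) (hcd : ⟪c, d⟫ = 0)
    (h : ⟪a - b, c - d⟫ = 0) :
    refl (a - b) * refl (c - d) ∈ weylGroup ↔ (1 / 2 : ℝ) • (a + b + c + d) ∈ lattice := by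
  have hnorm : ∀ {x y : V}, x ∈ roots → y ∈ roots → ⟪x, y⟫ = 0 → ⟪x - y, x - y⟫ = 4 :=
    fun hx hy hxy => by
      rw [real_inner_sub_sub_self, inner_self_of_mem_roots hx, inner_self_of_mem_roots hy, hxy]
      norm_num
  have hb' := mem_lattice_of_mem_roots hb
  have hd' := mem_lattice_of_mem_roots hd
  have hsum : (1 / 2 : ℝ) • (a - b + (c - d)) = (1 / 2 : ℝ) • (a + b + c + d) - (b + d) := by
    module
  rw [refl_mul_refl_mem_weylGroup_iff (sub_mem (mem_lattice_of_mem_roots ha) hb')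
    (sub_mem (mem_lattice_of_mem_roots hc) hd') (hnorm ha hb hab) (hnorm hc hd hcd) h, hsum,
    sub_eq_add_neg, lattice.add_mem_cancel_right (neg_mem (add_mem hb' hd'))]

theorem refl_sub_apply_eq_swap {ι : Type*} [DecidableEq ι] {v : ι → V} {r : ℝ}
    (hnorm : ∀ i, ‖v i‖ = r) (horth : Pairwise fun i j => ⟪v i, v j⟫ = 0) (a b i : ι) :
    refl (v a - v b) (v i) = v (Equiv.swap a b i) := by
  have hab : refl (v a - v b) (v a) = v b :=
    Submodule.reflection_sub ((hnorm a).trans (hnorm b).symm)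
  by_cases hia : i = a
  · rw [hia, Equiv.swap_apply_left, hab]
  by_cases hib : i = b
  · rw [hib, Equiv.swap_apply_right]
    exact (congrArg _ hab).symm.trans (refl_refl _ _)
  · rw [Equiv.swap_apply_of_ne_of_ne hia hib]
    exact refl_apply_of_inner_eq_zero (by rw [inner_sub_right, horth hia, horth hib, sub_zero])

theorem klein_subset_weylGroup_iff {α : Fin 4 → V} (hα : IsStronglyOrthogonalQuadruple α) :
    klein α ⊆ (weylGroup : Set (V ≃ₗᵢ[ℝ] V)) ↔ (1 / 2 : ℝ) • ∑ i, α i ∈ lattice := by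
  have horth : ∀ i j, i ≠ j → ⟪α i, α j⟫ = 0 := fun i j hij =>
    (stronglyOrthogonal_iff (hα.1 i) (hα.1 j)).1 (hα.2 hij)
  have key : ∀ i j k l, [i, j, k, l].Nodup →
      (refl (α i - α j) * refl (α k - α l) ∈ weylGroup ↔
        (1 / 2 : ℝ) • (α i + α j + α k + α l) ∈ lattice) := fun i j k l hnodup => by
    simp only [List.nodup_cons, List.mem_cons, List.not_mem_nil, or_false, not_or] at hnodup
    obtain ⟨⟨hij, hik, hil⟩, ⟨hjk, hjl⟩, hkl, -⟩ := hnodup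
    refine refl_sub_mul_refl_sub_mem_weylGroup_iff (hα.1 i) (hα.1 j) (hα.1 k) (hα.1 l)
      (horth i j hij) (horth k l hkl) ?_
    simp only [inner_sub_left, inner_sub_right, horth i k hik, horth i l hil, horth j k hjk,
      horth j l hjl, sub_zero]
  have hsum₁ : α 0 + α 2 + α 1 + α 3 = α 0 + α 1 + α 2 + α 3 := by abel
  have hsum₂ : α 0 + α 3 + α 1 + α 2 = α 0 + α 1 + α 2 + α 3 := by abel
  simp only [klein, Set.insert_subset_iff, Set.singleton_subset_iff, SetLike.mem_coe, one_mem,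
    true_and]
  rw [key 0 1 2 3 (by decide), key 0 2 1 3 (by decide), key 0 3 1 2 (by decide), hsum₁, hsum₂,
    Fin.sum_univ_four, and_self, and_self]

theorem IsStronglyOrthogonalQuadruple.injective {α : Fin 4 → V}
    (hα : IsStronglyOrthogonalQuadruple α) : Function.Injective α := fun i j h => by
  by_contra hij
  exact (hα.2 hij).1 h

theorem half_smul_sum_mem_lattice_iff_of_weylEquivalent {ι : Type*} [Fintype ι] {α β : ι → V}
    (hα : Function.Injective α) (hβ : Function.Injective β)
    (h : WeylEquivalent (Set.range α) (Set.range β)) :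
    (1 / 2 : ℝ) • ∑ i, α i ∈ lattice ↔ (1 / 2 : ℝ) • ∑ i, β i ∈ lattice := by
  obtain ⟨w, hw, hrange⟩ := h
  have hsum : w (∑ i, α i) = ∑ i, β i := by
    rw [map_sum, ← finsum_eq_sum_of_fintype, ← finsum_eq_sum_of_fintype,
      ← finsum_mem_range (f := fun x => x) hβ, ← hrange, ← Set.range_comp,
      finsum_mem_range (w.injective.comp hα)]
    rfl
  rw [← hsum, ← map_smul, map_mem_lattice_iff hw]

/-- Coordinates of a maximal system of orthogonal roots: its rows are `e₀ + e₁`, `e₀ - e₁`, …,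
`e₆ + e₇`, `e₆ - e₇`. With this order half the sum of four distinct rows lies in the `E₈` lattice
precisely when the bitwise sum of their indices vanishes. -/
def frameMatrix : Matrix (Fin 8) (Fin 8) ℤ :=
  !![1,  1, 0,  0, 0,  0, 0,  0;
     1, -1, 0,  0, 0,  0, 0,  0;
     0,  0, 1,  1, 0,  0, 0,  0;
     0,  0, 1, -1, 0,  0, 0,  0;
     0,  0, 0,  0, 1,  1, 0,  0;
     0,  0, 0,  0, 1, -1, 0,  0;
     0,  0, 0,  0, 0,  0, 1,  1;
     0,  0, 0,  0, 0,  0, 1, -1]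

/-- A maximal system of orthogonal roots, into which the Weyl group moves every other one. -/
noncomputable def frame (k : Fin 8) : V := WithLp.toLp 2 fun i => (frameMatrix k i : ℝ)

theorem frame_apply (k i : Fin 8) : frame k i = frameMatrix k i := rfl

theorem inner_frame_frame (k l : Fin 8) : ⟪frame k, frame l⟫ = if k = l then 2 else 0 := by
  have : ∀ k l, ∑ i, frameMatrix k i * frameMatrix l i = if k = l then 2 else 0 := by
    decide +kernel
  simp only [inner_eq_sum_mul, frame_apply]
  exact_mod_cast this k l

theorem frame_mem_roots (k : Fin 8) : frame k ∈ roots :=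
  mem_roots_of_int_coords (frame_apply k) (by rw [inner_frame_frame, if_pos rfl])

theorem pairwise_inner_frame_eq_zero : Pairwise fun k l => ⟪frame k, frame l⟫ = 0 :=
  fun k l hkl => (inner_frame_frame k l).trans (if_neg hkl)

theorem frame_injective : Function.Injective frame := fun k l h => by
  by_contra hkl
  have hkk := inner_frame_frame k k
  rw [congrArg (inner ℝ (frame k)) h, inner_frame_frame, if_neg hkl, if_pos rfl] at hkk
  norm_num at hkk

theorem exists_inner_frame_ne_zero {x : V} (hx : x ≠ 0) : ∃ k, ⟪x, frame k⟫ ≠ 0 := by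
  by_contra! h
  have hli : LinearIndependent ℝ frame :=
    linearIndependent_of_ne_zero_of_inner_eq_zero
      (fun k hk => by simpa [hk] using inner_frame_frame k k) pairwise_inner_frame_eq_zero
  have hspan : Submodule.span ℝ (Set.range frame) = ⊤ :=
    hli.span_eq_top_of_card_eq_finrank' (by simp)
  have hortho : x ∈ (Submodule.span ℝ (Set.range frame))ᗮ := by
    rw [Submodule.mem_orthogonal']
    intro y hy
    induction hy using Submodule.span_induction with
    | mem y hy => obtain ⟨k, rfl⟩ := hy; exact h k
    | zero => exact inner_zero_right x
    | add y z _ _ hy hz => rw [inner_add_right, hy, hz, add_zero]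
    | smul c y _ hy => rw [real_inner_smul_right, hy, mul_zero]
  rw [hspan, Submodule.top_orthogonal_eq_bot] at hortho
  exact hx hortho

theorem half_smul_mem_lattice {x : V} {n : Fin 8 → ℤ} (hn : ∀ i, x i = n i)
    (hdvd : ∀ i, 2 ∣ n i - n 0) (heven : Even (∑ i, (n i - n 0) / 2)) :
    (1 / 2 : ℝ) • x ∈ lattice := by
  refine ⟨n 0, fun i => (n i - n 0) / 2, fun i => ?_, heven⟩
  rw [PiLp.smul_apply, hn, smul_eq_mul, Int.cast_div (hdvd i) (by norm_num)]
  push_cast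
  ring

theorem half_smul_sum_frame_mem_lattice (a b c : Fin 8) :
    (1 / 2 : ℝ) • (frame a + frame b + frame c + frame (a ^^^ b ^^^ c)) ∈ lattice := by
  have hcode : ∀ a b c : Fin 8,
      let n := frameMatrix a + frameMatrix b + frameMatrix c + frameMatrix (a ^^^ b ^^^ c)
      (∀ i, 2 ∣ n i - n 0) ∧ Even (∑ i, (n i - n 0) / 2) := by
    decide +kernel
  obtain ⟨hdvd, heven⟩ := hcode a b c
  refine half_smul_mem_lattice (fun i => ?_) hdvd heven
  simp only [PiLp.add_apply, Pi.add_apply, frame_apply]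
  push_cast
  rfl

theorem exists_map_mem_range_frame {S : Finset V} (hS : (S : Set V) ⊆ roots)
    (horth : (S : Set V).Pairwise fun x y => ⟪x, y⟫ = 0) :
    ∃ w ∈ weylGroup, w '' S ⊆ Set.range frame := by
  induction S using Finset.induction with
  | empty => exact ⟨1, one_mem _, by simp⟩
  | insert x S hxS ih =>
    rw [Finset.coe_insert] at hS horth ⊢
    rw [Set.insert_subset_iff] at hS
    obtain ⟨w, hw, hwS⟩ := ih hS.2 (horth.mono (Set.subset_insert x S))
    have hwx := map_mem_roots hw hS.1
    obtain ⟨k, hk⟩ := exists_inner_frame_ne_zero (x := w x) fun h => by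
      simpa [h] using inner_self_of_mem_roots hwx
    obtain ⟨g, hg, hgx, hfix⟩ := exists_map_eq_of_inner_ne_zero hwx (frame_mem_roots k) hk
    refine ⟨g * w, mul_mem hg hw, ?_⟩
    rw [LinearIsometryEquiv.coe_mul, Set.image_comp, Set.image_insert_eq, Set.image_insert_eq,
      hgx, Set.insert_subset_iff]
    refine ⟨⟨k, rfl⟩, ?_⟩
    rintro _ ⟨_, ⟨y, hy, rfl⟩, rfl⟩
    obtain ⟨l, hl⟩ := hwS ⟨y, hy, rfl⟩
    have hyx : ⟪w y, w x⟫ = 0 := by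
      rw [LinearIsometryEquiv.inner_map_map]
      exact horth (Set.mem_insert_of_mem x hy) (Set.mem_insert x S) fun h => hxS (h ▸ hy)
    have hlk : l ≠ k := by
      rintro rfl
      exact hk (by rw [hl, real_inner_comm, hyx])
    rw [hfix _ hyx (by rw [← hl, pairwise_inner_frame_eq_zero hlk])]
    exact ⟨l, hl⟩

theorem IsStronglyOrthogonalSystem.exists_weylEquivalent_frame {S : Finset V}
    (hS : IsStronglyOrthogonalSystem S) :
    ∃ A : Finset (Fin 8), A.card = S.card ∧ WeylEquivalent S (frame '' A) := by
  classical
  obtain ⟨w, hw, hwS⟩ := exists_map_mem_range_frame hS.1 fun x hx y hy hxy =>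
    (stronglyOrthogonal_iff (hS.1 hx) (hS.1 hy)).1 (hS.2 hx hy hxy)
  obtain ⟨A, -, hA⟩ := Finset.subset_set_image_iff.1
    (by rwa [Set.image_univ, Finset.coe_image] : (↑(S.image w) : Set V) ⊆ frame '' Set.univ)
  refine ⟨A, ?_, w, hw, ?_⟩
  · rw [← Finset.card_image_of_injective A frame_injective, hA,
      Finset.card_image_of_injective S w.injective]
  · rw [← Finset.coe_image, ← Finset.coe_image, hA]

/-- The permutations of the frame that are induced by elements of the Weyl group. -/
def framePerm : Submonoid (Equiv.Perm (Fin 8)) where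
  carrier := {σ | ∃ w ∈ weylGroup, ∀ k, w (frame k) = frame (σ k)}
  one_mem' := ⟨1, one_mem _, fun _ => rfl⟩
  mul_mem' := by
    rintro σ τ ⟨w, hw, hσ⟩ ⟨w', hw', hτ⟩
    exact ⟨w * w', mul_mem hw hw', fun k => by
      rw [LinearIsometryEquiv.coe_mul, Function.comp_apply, hτ, hσ, Equiv.Perm.mul_apply]⟩

theorem weylEquivalent_frame_image {σ : Equiv.Perm (Fin 8)} (hσ : σ ∈ framePerm)
    (A : Finset (Fin 8)) : WeylEquivalent (frame '' A) (frame '' (A.image σ)) := by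
  obtain ⟨w, hw, h⟩ := hσ
  refine ⟨w, hw, ?_⟩
  rw [Finset.coe_image, ← Set.image_comp, ← Set.image_comp]
  exact Set.image_congr fun k _ => h k

theorem swap_mul_swap_mem_framePerm {i j c : Fin 8} (hij : i ≠ j) (hci : c ≠ i) (hcj : c ≠ j) :
    Equiv.swap i j * Equiv.swap c (i ^^^ j ^^^ c) ∈ framePerm := by
  have hd : ∀ i j c : Fin 8, i ≠ j → c ≠ i → c ≠ j →
      i ^^^ j ^^^ c ≠ c ∧ i ^^^ j ^^^ c ≠ i ∧ i ^^^ j ^^^ c ≠ j := by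
    decide +kernel
  obtain ⟨hdc, hdi, hdj⟩ := hd i j c hij hci hcj
  have hnorm : ∀ k, ‖frame k‖ = √2 := fun k => by
    rw [norm_eq_sqrt_real_inner, inner_frame_frame, if_pos rfl]
  refine ⟨refl (frame i - frame j) * refl (frame c - frame (i ^^^ j ^^^ c)), ?_, fun k => ?_⟩
  · refine (refl_sub_mul_refl_sub_mem_weylGroup_iff (frame_mem_roots _) (frame_mem_roots _)
      (frame_mem_roots _) (frame_mem_roots _) (pairwise_inner_frame_eq_zero hij)
      (pairwise_inner_frame_eq_zero hdc.symm) ?_).2 (half_smul_sum_frame_mem_lattice i j c)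
    simp only [inner_sub_left, inner_sub_right, pairwise_inner_frame_eq_zero hci.symm,
      pairwise_inner_frame_eq_zero hcj.symm, pairwise_inner_frame_eq_zero hdi.symm,
      pairwise_inner_frame_eq_zero hdj.symm, sub_zero]
  · rw [LinearIsometryEquiv.coe_mul, Function.comp_apply, Equiv.Perm.mul_apply,
      refl_sub_apply_eq_swap hnorm pairwise_inner_frame_eq_zero,
      refl_sub_apply_eq_swap hnorm pairwise_inner_frame_eq_zero]

/- Otherwise the translation by `i ^^^ j` would interchange `A` with its complement. -/
theorem exists_mem_iff_xor_mem {A : Finset (Fin 8)} (hA : A.card ≠ 4) {i j : Fin 8}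
    (hi : i ∈ A) (hj : j ∉ A) : ∃ c, c ≠ i ∧ c ≠ j ∧ (c ∈ A ↔ i ^^^ j ^^^ c ∈ A) := by
  by_contra h
  have hij : ∀ i j : Fin 8, i ^^^ j ^^^ i = j ∧ i ^^^ j ^^^ j = i := by decide +kernel
  have hinvol : Function.Involutive (i ^^^ j ^^^ ·) := by
    have : ∀ i j c : Fin 8, i ^^^ j ^^^ (i ^^^ j ^^^ c) = c := by decide +kernel
    exact this i j
  have hswap : ∀ c, c ∈ Aᶜ ↔ i ^^^ j ^^^ c ∈ A := fun c => by
    rw [Finset.mem_compl]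
    rcases eq_or_ne c i with rfl | hci
    · simp only [hi, (hij c j).1, hj, not_true]
    rcases eq_or_ne c j with rfl | hcj
    · simp only [hi, (hij i c).2, hj, not_false_eq_true]
    · exact not_iff_comm.1 (not_iff.1 fun hc => h ⟨c, hci, hcj, hc.symm⟩)
  have hcard : Aᶜ.card = A.card :=
    Finset.card_bijective _ hinvol.bijective fun {c} => hswap c
  rw [Finset.card_compl, Fintype.card_fin] at hcard
  omega

theorem exists_framePerm_image_eq_insert_erase {A : Finset (Fin 8)} {i j c : Fin 8}
    (hi : i ∈ A) (hj : j ∉ A) (hci : c ≠ i) (hcj : c ≠ j) (hc : c ∈ A ↔ i ^^^ j ^^^ c ∈ A) :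
    ∃ σ ∈ framePerm, A.image σ = insert j (A.erase i) := by
  have hij : i ≠ j := ne_of_mem_of_not_mem hi hj
  refine ⟨_, swap_mul_swap_mem_framePerm hij hci hcj, ?_⟩
  have hfix : A.image (Equiv.swap c (i ^^^ j ^^^ c)) = A := by
    refine Finset.eq_of_subset_of_card_le (Finset.image_subset_iff.2 fun k hk => ?_)
      (Finset.card_image_of_injective A (Equiv.injective _)).ge
    rw [Equiv.swap_apply_def]
    split_ifs with hkc hkd
    · exact hc.1 (hkc ▸ hk)
    · exact hc.2 (hkd ▸ hk)
    · exact hk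
  have hmove : A.image (Equiv.swap i j) = insert j (A.erase i) := by
    have herase : (A.erase i).image (Equiv.swap i j) = A.erase i := by
      rw [Finset.image_congr (g := id) fun k hk => ?_, Finset.image_id]
      obtain ⟨hki, hk⟩ := Finset.mem_erase.1 hk
      exact Equiv.swap_apply_of_ne_of_ne hki (ne_of_mem_of_not_mem hk hj)
    nth_rw 1 [← Finset.insert_erase hi]
    rw [Finset.image_insert, Equiv.swap_apply_left, herase]
  rw [Equiv.Perm.coe_mul, ← Finset.image_image, hfix, hmove]

theorem exists_framePerm_image_eq {A B : Finset (Fin 8)} (hAB : A.card = B.card)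
    (hA : A.card ≠ 4) : ∃ σ ∈ framePerm, A.image σ = B := by
  induction h : (A \ B).card generalizing A with
  | zero =>
    have hsub : A ⊆ B := Finset.sdiff_eq_empty_iff_subset.1 (Finset.card_eq_zero.1 h)
    exact ⟨1, one_mem _, by simp [Finset.eq_of_subset_of_card_le hsub hAB.ge]⟩
  | succ n ih =>
    obtain ⟨i, hi⟩ : (A \ B).Nonempty := Finset.card_pos.1 (by omega)
    obtain ⟨j, hj⟩ : (B \ A).Nonempty :=
      Finset.card_pos.1 (by rw [← Finset.card_sdiff_comm hAB]; omega)
    rw [Finset.mem_sdiff] at hi hj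
    obtain ⟨c, hci, hcj, hc⟩ := exists_mem_iff_xor_mem hA hi.1 hj.2
    obtain ⟨σ, hσ, hσA⟩ := exists_framePerm_image_eq_insert_erase hi.1 hj.2 hci hcj hc
    have hcard : (A.image σ).card = A.card := Finset.card_image_of_injective A σ.injective
    have hsdiff : A.image σ \ B = (A \ B).erase i := by
      rw [hσA, Finset.insert_sdiff_of_mem _ hj.1, Finset.erase_sdiff_comm]
    obtain ⟨τ, hτ, hτB⟩ := ih (hcard.trans hAB) (hcard ▸ hA) (by
      rw [hsdiff, Finset.card_erase_of_mem (Finset.mem_sdiff.2 hi), h, Nat.add_sub_cancel])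
    exact ⟨τ * σ, mul_mem hτ hσ, by rw [Equiv.Perm.coe_mul, ← Finset.image_image, hτB]⟩

theorem IsStronglyOrthogonalSystem.weylEquivalent {S T : Finset V}
    (hS : IsStronglyOrthogonalSystem S) (hT : IsStronglyOrthogonalSystem T)
    (hST : S.card = T.card) (hcard : S.card ≠ 4) : WeylEquivalent S T := by
  obtain ⟨A, hA, hSA⟩ := hS.exists_weylEquivalent_frame
  obtain ⟨B, hB, hTB⟩ := hT.exists_weylEquivalent_frame
  obtain ⟨σ, hσ, rfl⟩ :=
    exists_framePerm_image_eq (hA.trans (hST.trans hB.symm)) (hA.trans_ne hcard)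
  exact hSA.trans ((weylEquivalent_frame_image hσ A).trans hTB.symm)

theorem exists_framePerm_image_eq_of_card_eq_four {A : Finset (Fin 8)} (hA : A.card = 4) :
    ∃ σ ∈ framePerm, A.image σ = {0, 1, 2, 3} ∨ A.image σ = {0, 1, 2, 4} := by
  obtain ⟨x, hx⟩ : A.Nonempty := Finset.card_pos.1 (by omega)
  have hcard : (A.erase x).card = 3 := by rw [Finset.card_erase_of_mem hx, hA]
  obtain ⟨σ, hσ, hσA⟩ := exists_framePerm_image_eq (B := {0, 1, 2}) hcard (by omega)
  have hσx : σ x ∉ ({0, 1, 2} : Finset (Fin 8)) := by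
    rw [← hσA, σ.injective.mem_finset_image]
    exact Finset.notMem_erase x A
  have himage : A.image σ = insert (σ x) {0, 1, 2} := by
    rw [← hσA, ← Finset.image_insert, Finset.insert_erase hx]
  have hexchange : ∀ t ∉ ({0, 1, 2} : Finset (Fin 8)), t = 3 ∨ t = 4 ∨
      let B : Finset (Fin 8) := {t, 0, 1, 2}
      4 ∉ B ∧ ∃ c, c ≠ t ∧ c ≠ 4 ∧ (c ∈ B ↔ t ^^^ 4 ^^^ c ∈ B) := by
    decide +kernel
  obtain h | h | ⟨h4, c, hct, hc4, hc⟩ := hexchange _ hσx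
  · exact ⟨σ, hσ, Or.inl (by rw [himage, h]; decide)⟩
  · exact ⟨σ, hσ, Or.inr (by rw [himage, h]; decide)⟩
  · obtain ⟨τ, hτ, hτσ⟩ := exists_framePerm_image_eq_insert_erase
      (Finset.mem_insert_self _ _) h4 hct hc4 hc
    refine ⟨τ * σ, mul_mem hτ hσ, Or.inr ?_⟩
    rw [Equiv.Perm.coe_mul, ← Finset.image_image, himage, hτσ, Finset.erase_insert hσx]
    decide

theorem IsStronglyOrthogonalQuadruple.weylEquivalent_frame {α : Fin 4 → V}
    (hα : IsStronglyOrthogonalQuadruple α) :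
    WeylEquivalent (Set.range α) (Set.range (frame ∘ ![0, 1, 2, 3])) ∨
      WeylEquivalent (Set.range α) (Set.range (frame ∘ ![0, 1, 2, 4])) := by
  classical
  have hsystem : IsStronglyOrthogonalSystem (Finset.univ.image α) := by
    rw [IsStronglyOrthogonalSystem, Finset.coe_image, Finset.coe_univ, Set.image_univ]
    refine ⟨Set.range_subset_iff.2 hα.1, ?_⟩
    rintro _ ⟨i, rfl⟩ _ ⟨j, rfl⟩ hij
    exact hα.2 fun h => hij (congrArg α h)
  obtain ⟨A, hA, hαA⟩ := hsystem.exists_weylEquivalent_frame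
  rw [Finset.coe_image, Finset.coe_univ, Set.image_univ] at hαA
  rw [Finset.card_image_of_injective _ hα.injective, Finset.card_univ, Fintype.card_fin] at hA
  obtain ⟨σ, hσ, h⟩ := exists_framePerm_image_eq_of_card_eq_four hA
  have hασ := hαA.trans (weylEquivalent_frame_image hσ A)
  have hrange : ∀ s : Fin 4 → Fin 8, A.image σ = Finset.univ.image s →
      WeylEquivalent (Set.range α) (Set.range (frame ∘ s)) := fun s hs => by
    rwa [hs, Finset.coe_image, Finset.coe_univ, Set.image_univ, ← Set.range_comp] at hασ
  exact h.imp (fun h => hrange _ (h.trans (by decide))) fun h => hrange _ (h.trans (by decide))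

theorem isStronglyOrthogonalQuadruple_frame_comp {s : Fin 4 → Fin 8}
    (hs : Function.Injective s) : IsStronglyOrthogonalQuadruple (frame ∘ s) :=
  ⟨fun _ => frame_mem_roots _, fun _ _ hij => (stronglyOrthogonal_iff (frame_mem_roots _)
    (frame_mem_roots _)).2 (pairwise_inner_frame_eq_zero (hs.ne hij))⟩

theorem klein_frame_subset_weylGroup :
    klein (frame ∘ ![0, 1, 2, 3]) ⊆ (weylGroup : Set (V ≃ₗᵢ[ℝ] V)) := by
  rw [klein_subset_weylGroup_iff (isStronglyOrthogonalQuadruple_frame_comp (by decide)),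
    Fin.sum_univ_four]
  exact half_smul_sum_frame_mem_lattice 0 1 2

theorem not_klein_frame_subset_weylGroup :
    ¬ klein (frame ∘ ![0, 1, 2, 4]) ⊆ (weylGroup : Set (V ≃ₗᵢ[ℝ] V)) := by
  rw [klein_subset_weylGroup_iff (isStronglyOrthogonalQuadruple_frame_comp (by decide)),
    Fin.sum_univ_four]
  intro h
  obtain ⟨n, hn⟩ := exists_int_inner_eq (e_add_e_mem_lattice 0 2) h
  have hhalf : (2⁻¹ + 2⁻¹ + 2⁻¹ : ℝ) = n := by
    simpa [inner_add_left, inner_e_left, frame_apply, frameMatrix] using hn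
  have : 3 = 2 * n := by exact_mod_cast (by linarith : (3 : ℝ) = 2 * n)
  omega

theorem klein_subset_weylGroup_iff_of_weylEquivalent {α β : Fin 4 → V}
    (hα : IsStronglyOrthogonalQuadruple α) (hβ : IsStronglyOrthogonalQuadruple β)
    (h : WeylEquivalent (Set.range α) (Set.range β)) :
    klein α ⊆ (weylGroup : Set (V ≃ₗᵢ[ℝ] V)) ↔ klein β ⊆ (weylGroup : Set (V ≃ₗᵢ[ℝ] V)) := by
  rw [klein_subset_weylGroup_iff hα, klein_subset_weylGroup_iff hβ,
    half_smul_sum_mem_lattice_iff_of_weylEquivalent hα.injective hβ.injective h]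

theorem weylEquivalent_range_iff {α β : Fin 4 → V} (hα : IsStronglyOrthogonalQuadruple α)
    (hβ : IsStronglyOrthogonalQuadruple β) :
    WeylEquivalent (Set.range α) (Set.range β) ↔
      (klein α ⊆ (weylGroup : Set (V ≃ₗᵢ[ℝ] V)) ↔
        klein β ⊆ (weylGroup : Set (V ≃ₗᵢ[ℝ] V))) := by
  refine ⟨klein_subset_weylGroup_iff_of_weylEquivalent hα hβ, fun h => ?_⟩
  have hfirst : ∀ {γ}, IsStronglyOrthogonalQuadruple γ →
      WeylEquivalent (Set.range γ) (Set.range (frame ∘ ![0, 1, 2, 3])) →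
      klein γ ⊆ (weylGroup : Set (V ≃ₗᵢ[ℝ] V)) := fun hγ hequiv =>
    (klein_subset_weylGroup_iff_of_weylEquivalent hγ
      (isStronglyOrthogonalQuadruple_frame_comp (by decide)) hequiv).2 klein_frame_subset_weylGroup
  have hsecond : ∀ {γ}, IsStronglyOrthogonalQuadruple γ →
      WeylEquivalent (Set.range γ) (Set.range (frame ∘ ![0, 1, 2, 4])) →
      ¬ klein γ ⊆ (weylGroup : Set (V ≃ₗᵢ[ℝ] V)) := fun hγ hequiv =>
    mt (klein_subset_weylGroup_iff_of_weylEquivalent hγ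
      (isStronglyOrthogonalQuadruple_frame_comp (by decide)) hequiv).1
      not_klein_frame_subset_weylGroup
  rcases hα.weylEquivalent_frame with hα' | hα' <;>
    rcases hβ.weylEquivalent_frame with hβ' | hβ'
  · exact hα'.trans hβ'.symm
  · exact absurd (h.1 (hfirst hα hα')) (hsecond hβ hβ')
  · exact absurd (h.2 (hfirst hβ hβ')) (hsecond hα hα')
  · exact hα'.trans hβ'.symm

end E8

theorem mainTheorem12 :
    (∀ k : ℕ, k ≠ 4 → ∀ S T : Finset E8.V,
      E8.IsStronglyOrthogonalSystem S → S.card = k →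
      E8.IsStronglyOrthogonalSystem T → T.card = k →
      E8.WeylEquivalent (S : Set E8.V) (T : Set E8.V)) ∧
    (∀ α β : Fin 4 → E8.V,
      E8.IsStronglyOrthogonalQuadruple α → E8.IsStronglyOrthogonalQuadruple β →
      (E8.WeylEquivalent (Set.range α) (Set.range β) ↔
        (E8.klein α ⊆ (E8.weylGroup : Set (E8.V ≃ₗᵢ[ℝ] E8.V)) ↔
          E8.klein β ⊆ (E8.weylGroup : Set (E8.V ≃ₗᵢ[ℝ] E8.V))))) ∧
    (∃ α : Fin 4 → E8.V, E8.IsStronglyOrthogonalQuadruple α ∧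
      E8.klein α ⊆ (E8.weylGroup : Set (E8.V ≃ₗᵢ[ℝ] E8.V))) ∧
    (∃ α : Fin 4 → E8.V, E8.IsStronglyOrthogonalQuadruple α ∧
      ¬ E8.klein α ⊆ (E8.weylGroup : Set (E8.V ≃ₗᵢ[ℝ] E8.V))) := by
  refine ⟨?_, fun α β hα hβ => E8.weylEquivalent_range_iff hα hβ,
    ⟨_, E8.isStronglyOrthogonalQuadruple_frame_comp (by decide), E8.klein_frame_subset_weylGroup⟩,
    ⟨_, E8.isStronglyOrthogonalQuadruple_frame_comp (by decide),
      E8.not_klein_frame_subset_weylGroup⟩⟩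
  rintro k hk S T hS rfl hT hTS
  exact hS.weylEquivalent hT hTS.symm hk
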